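/- For $S\subseteq\mathbb{R}^d$ let $\omega(S)=\mathbb{E}_{g}\big[\sup_{v\in S}\langle g,v\rangle\big]$, with $g\in\mathbb{R}^d$ a vector of independent standard normal variables, be its Gaussian width. For a real matrix $Y\in\mathbb{R}^{d\times n}$ let $\omega(Y)$ be the Gaussian width of the set $\{y_1,\dots,y_n\}$ of its columns, and for $\epsilon>0$ let $$\mathrm{rank}_\epsilon(Y)=\min\big\{\mathrm{rank}(\hat Y):\ \hat Y\in\mathbb{R}^{d\times n},\ |Y_{ij}-\hat Y_{ij}|\le\epsilon\text{ for all }i,j\big\}$$ be its $\epsilon$-approximate rank. For every constant $c>0$ there is a constant $C>0$, depending only on $c$, such that for all integers $d,n\ge1$, every $Y\in\mathbb{R}^{d\times n}$ with $\|y_j\|_2=1$ for all $j$, and every $\epsilon\ge c/\sqrt d$ (where, if $d=1$, also $\epsilon\ge1$ is required), $$\mathrm{rank}_\epsilon(Y)\ \le\ \frac{C}{\epsilon^2}\,\max\big(\omega(Y)^2,\ \log d\big).$$ -/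

import Mathlib

open MeasureTheory ProbabilityTheory

/-- The Gaussian width `ω(S) = E_g [sup_{v ∈ S} ⟨g, v⟩]` of a set `S ⊆ ℝ^d`, where `g` is a vector
of `d` independent standard normal variables. -/
noncomputable def gaussianWidth {d : ℕ} (S : Set (EuclideanSpace ℝ (Fin d))) : ℝ :=
  ∫ g, (⨆ v : S, inner ℝ g (v : EuclideanSpace ℝ (Fin d)))
    ∂(stdGaussian (EuclideanSpace ℝ (Fin d)))

/-- The `j`-th column of a matrix, as a vector with the Euclidean norm. -/
def matCol {d n : ℕ} (Y : Matrix (Fin d) (Fin n) ℝ) (j : Fin n) : EuclideanSpace ℝ (Fin d) :=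
  WithLp.toLp 2 (fun i => Y i j)

/-- The `ε`-approximate rank of `Y`: the least rank of a matrix of the same shape all of whose
entries differ by at most `ε` from those of `Y`. -/
noncomputable def approxRank {m n : ℕ} (ε : ℝ) (Y : Matrix (Fin m) (Fin n) ℝ) : ℕ :=
  sInf {r : ℕ | ∃ Z : Matrix (Fin m) (Fin n) ℝ, (∀ i j, |Y i j - Z i j| ≤ ε) ∧ Z.rank = r}

/-- For `ε ≥ 0` the minimum in the definition of the approximate rank is attained. -/
theorem approxRank_attained {m n : ℕ} {ε : ℝ} (hε : 0 ≤ ε) (Y : Matrix (Fin m) (Fin n) ℝ) :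
    ∃ Z : Matrix (Fin m) (Fin n) ℝ, (∀ i j, |Y i j - Z i j| ≤ ε) ∧ Z.rank = approxRank ε Y :=
  Nat.sInf_mem (s := {r : ℕ | ∃ Z : Matrix (Fin m) (Fin n) ℝ,
    (∀ i j, |Y i j - Z i j| ≤ ε) ∧ Z.rank = r}) ⟨Y.rank, Y, fun i j => by simpa using hε, rfl⟩

/-! The approximant is a random projection: for a k × d standard Gaussian matrix `G`, the matrix
`k⁻¹ GᵀG Y` has rank at most k and mean `Y`. It remains to find one `G` for which `k⟨u, v⟩ - ⟨Gu,
Gv⟩` is at most `εk` for all signed basis vectors u and all columns v. A union bound over pairs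
would cost `log n`; instead the supremum over v stays inside an exponential moment, where it costs
`ω(Y)²`, and only the 2d vectors u are summed over, at cost `log(2d)`.

The moment is bounded by decoupling. If `H` is an independent copy of `G`, the mean over `H` of
`⟨(G+H)u, (H-G)v⟩` is exactly the deviation, so Jensen bounds its exponential by a mean over `H`.
Rotation by π/4 turns `G+H` and `H-G` into independent Gaussian matrices
(`lintegral_exp_supInner_decoupled_le`). Given `w = Gu`, the vector `Hᵀw` has the law of `‖w‖g`, so
the supremum becomes `‖w‖ sup_v ⟨g, v⟩`. This is controlled by Gaussian concentration
(`lintegral_exp_supInner_le`), proved by the Maurey–Pisier rotation argument, and `‖w‖²` is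
chi-square. -/

/-! ### Gaussian concentration of the support function -/

section GaussianSup

theorem ofReal_exp_integral_le_lintegral {α : Type*} [MeasurableSpace α] {μ : Measure α}
    [IsProbabilityMeasure μ] {f : α → ℝ} (hf : Integrable f μ) :
    ENNReal.ofReal (Real.exp (∫ x, f x ∂μ)) ≤ ∫⁻ x, ENNReal.ofReal (Real.exp (f x)) ∂μ := by
  by_cases h : ∫⁻ x, ENNReal.ofReal (Real.exp (f x)) ∂μ = ⊤
  · simp [h]
  · have hi : Integrable (fun x => Real.exp (f x)) μ := by
      refine ⟨Real.continuous_exp.comp_aestronglyMeasurable hf.1, ?_⟩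
      rw [hasFiniteIntegral_iff_ofReal (ae_of_all _ fun _ => (Real.exp_pos _).le)]
      exact lt_top_iff_ne_top.2 h
    rw [← ofReal_integral_eq_lintegral_ofReal hi (ae_of_all _ fun _ => (Real.exp_pos _).le)]
    exact ENNReal.ofReal_le_ofReal (convexOn_exp.map_integral_le Real.continuous_exp.continuousOn
      isClosed_univ (ae_of_all _ fun _ => Set.mem_univ _) hf hi)

variable {E : Type*} [NormedAddCommGroup E] [InnerProductSpace ℝ E] {ι : Type*}

/-- The support function of a finite family of vectors. -/
noncomputable def supInner (v : ι → E) (x : E) : ℝ := ⨆ j, inner ℝ x (v j)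

theorem inner_le_supInner [Finite ι] (v : ι → E) (x : E) (j : ι) : inner ℝ x (v j) ≤ supInner v x :=
  le_ciSup (f := fun j => (inner ℝ x (v j) : ℝ)) (Set.finite_range _).bddAbove j

theorem supInner_smul (v : ι → E) {c : ℝ} (hc : 0 ≤ c) (x : E) :
    supInner v (c • x) = c * supInner v x := by
  simp_rw [supInner, real_inner_smul_left]
  exact (Real.mul_iSup_of_nonneg hc _).symm

theorem exists_supInner_eq [Finite ι] [Nonempty ι] (v : ι → E) (x : E) : ∃ j, supInner v x = inner ℝ x (v j) := by
  obtain ⟨j, hj⟩ := exists_eq_ciSup_of_finite (f := fun j => (inner ℝ x (v j) : ℝ))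
  exact ⟨j, hj.symm⟩

variable [FiniteDimensional ℝ E] [MeasurableSpace E] [BorelSpace E]

theorem map_inner_stdGaussian (v : E) :
    (stdGaussian E).map (fun x => inner ℝ x v) = gaussianReal 0 (Real.toNNReal (‖v‖ ^ 2)) := by
  have h := IsGaussian.map_eq_gaussianReal (μ := stdGaussian E) (innerSL ℝ v)
  rw [variance_dual_stdGaussian, integral_strongDual_stdGaussian, innerSL_apply_norm] at h
  rw [← h]
  congr 1
  ext x
  simp [real_inner_comm]

theorem mgf_inner_stdGaussian (v : E) (t : ℝ) :
    mgf (fun x => inner ℝ x v) (stdGaussian E) t = Real.exp (‖v‖ ^ 2 * t ^ 2 / 2) := by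
  rw [mgf_gaussianReal (map_inner_stdGaussian v)]
  simp

theorem integrable_exp_inner_stdGaussian (v : E) (t : ℝ) :
    Integrable (fun x => Real.exp (t * inner ℝ x v)) (stdGaussian E) := by
  have := mgf_pos_iff (μ := stdGaussian E) (X := fun x => inner ℝ x v) (t := t)
  rw [← this, mgf_inner_stdGaussian]
  positivity

theorem lintegral_exp_inner_stdGaussian (v : E) (t : ℝ) :
    ∫⁻ x, ENNReal.ofReal (Real.exp (t * inner ℝ x v)) ∂(stdGaussian E)
      = ENNReal.ofReal (Real.exp (‖v‖ ^ 2 * t ^ 2 / 2)) := by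
  rw [← ofReal_integral_eq_lintegral_ofReal (integrable_exp_inner_stdGaussian v t)
    (ae_of_all _ fun _ => (Real.exp_pos _).le), ← mgf_inner_stdGaussian]
  rfl

variable [Fintype ι]

theorem measurable_supInner (v : ι → E) : Measurable (supInner v) :=
  Measurable.iSup fun j => by fun_prop

variable [Nonempty ι]

theorem integrable_exp_supInner (v : ι → E) (t : ℝ) :
    Integrable (fun x => Real.exp (t * supInner v x)) (stdGaussian E) := by
  refine Integrable.mono' (g := fun x => ∑ j, Real.exp (t * inner ℝ x (v j)))
    (integrable_finsetSum _ fun j _ => integrable_exp_inner_stdGaussian (v j) t)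
    (((measurable_supInner v).const_mul t).exp.aestronglyMeasurable) (ae_of_all _ fun x => ?_)
  obtain ⟨j, hj⟩ := exists_supInner_eq v x
  rw [Real.norm_of_nonneg (Real.exp_pos _).le, hj]
  exact Finset.single_le_sum (f := fun j => Real.exp (t * inner ℝ x (v j)))
    (fun _ _ => (Real.exp_pos _).le) (Finset.mem_univ j)

theorem integrable_supInner (v : ι → E) : Integrable (supInner v) (stdGaussian E) := by
  refine Integrable.mono' (g := fun x => ∑ j, |inner ℝ x (v j)|)
    (integrable_finsetSum _ fun j _ => ?_)
    (measurable_supInner v).aestronglyMeasurable (ae_of_all _ fun x => ?_)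
  · have := (IsGaussian.integrable_dual (stdGaussian E) (innerSL ℝ (v j))).abs
    simpa [real_inner_comm] using this
  · obtain ⟨j, hj⟩ := exists_supInner_eq v x
    rw [Real.norm_eq_abs, hj]
    exact Finset.single_le_sum (f := fun j => |(inner ℝ x (v j) : ℝ)|)
      (fun _ _ => abs_nonneg _) (Finset.mem_univ j)

/-- A vector `v j` attaining the supremum at `x` is still a competitor at `c • x + s • z`. Hence the
difference is at most `(1 - c) * supInner v x - s * ⟨z, v j⟩`, whose second term is Gaussian in `z`
for fixed `x`. -/
theorem lintegral_exp_supInner_sub_le {v : ι → E} (hv : ∀ j, ‖v j‖ ≤ 1) {a : ℝ} (ha : 0 ≤ a)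
    (c s : ℝ) :
    ∫⁻ p : E × E, ENNReal.ofReal
        (Real.exp (a * (supInner v p.1 - supInner v (c • p.1 + s • p.2))))
        ∂((stdGaussian E).prod (stdGaussian E))
      ≤ ENNReal.ofReal (Real.exp (a ^ 2 * s ^ 2 / 2)) *
        ∫⁻ x, ENNReal.ofReal (Real.exp (a * (1 - c) * supInner v x)) ∂(stdGaussian E) := by
  have hm := measurable_supInner v
  rw [lintegral_prod _ (by fun_prop), ← lintegral_const_mul _ (by fun_prop)]
  refine lintegral_mono fun x => ?_
  obtain ⟨j, hj⟩ := exists_supInner_eq v x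
  calc ∫⁻ z, ENNReal.ofReal (Real.exp (a * (supInner v x - supInner v (c • x + s • z))))
        ∂(stdGaussian E)
      ≤ ∫⁻ z, ENNReal.ofReal (Real.exp (a * (1 - c) * supInner v x)) *
          ENNReal.ofReal (Real.exp ((-(a * s)) * inner ℝ z (v j))) ∂(stdGaussian E) := by
        refine lintegral_mono fun z => ?_
        rw [← ENNReal.ofReal_mul (Real.exp_pos _).le, ← Real.exp_add]
        refine ENNReal.ofReal_le_ofReal (Real.exp_le_exp.2 ?_)
        have h := inner_le_supInner v (c • x + s • z) j
        rw [inner_add_left, real_inner_smul_left, real_inner_smul_left, ← hj] at h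
        nlinarith [mul_le_mul_of_nonneg_left h ha]
    _ = ENNReal.ofReal (Real.exp (a * (1 - c) * supInner v x)) *
          ENNReal.ofReal (Real.exp (‖v j‖ ^ 2 * (-(a * s)) ^ 2 / 2)) := by
        rw [lintegral_const_mul _ (by fun_prop), lintegral_exp_inner_stdGaussian]
    _ ≤ _ := by
        rw [mul_comm]
        refine mul_le_mul_left (ENNReal.ofReal_le_ofReal (Real.exp_le_exp.2 ?_)) _
        have : ‖v j‖ ^ 2 ≤ 1 := pow_le_one₀ (norm_nonneg _) (hv j)
        nlinarith [mul_le_mul_of_nonneg_right this (sq_nonneg (a * s))]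

theorem map_rotation_stdGaussian_prod (θ : ℝ) :
    ((stdGaussian E).prod (stdGaussian E)).map (ContinuousLinearMap.rotation θ) =
      (stdGaussian E).prod (stdGaussian E) :=
  IsGaussian.map_rotation_eq_self (by simp) θ

theorem lintegral_comp_rotation_stdGaussian_prod {f : E × E → ENNReal} (hf : Measurable f)
    (θ : ℝ) :
    ∫⁻ p, f (ContinuousLinearMap.rotation θ p) ∂((stdGaussian E).prod (stdGaussian E)) =
      ∫⁻ p, f p ∂((stdGaussian E).prod (stdGaussian E)) := by
  conv_rhs => rw [← map_rotation_stdGaussian_prod θ]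
  rw [lintegral_map hf (by fun_prop)]

theorem lintegral_lintegral_comp_rotation_stdGaussian {f : E × E → ENNReal} (hf : Measurable f)
    (θ : ℝ) :
    ∫⁻ x, ∫⁻ y, f (ContinuousLinearMap.rotation θ (x, y)) ∂(stdGaussian E) ∂(stdGaussian E) =
      ∫⁻ x, ∫⁻ y, f (x, y) ∂(stdGaussian E) ∂(stdGaussian E) := by
  rw [← lintegral_prod _ hf.aemeasurable, ← lintegral_comp_rotation_stdGaussian_prod hf θ,
    ← lintegral_prod (fun p => f (ContinuousLinearMap.rotation θ p)) (by fun_prop)]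

/-- The quarter circle from `p.1` to `p.2` is cut into `N` equal arcs. By rotation invariance every
increment has the law of the first one, and convexity of `exp` bounds the exponential of their sum
by the average of the exponentials of `N` times each. This discrete path needs no differentiability
of the support function. -/
theorem lintegral_exp_supInner_sub_le_of_steps {v : ι → E} (hv : ∀ j, ‖v j‖ ≤ 1) {t : ℝ}
    (ht : 0 ≤ t) {N : ℕ} (hN : 0 < N) :
    ∫⁻ p : E × E, ENNReal.ofReal (Real.exp (t * (supInner v p.1 - supInner v p.2)))
        ∂((stdGaussian E).prod (stdGaussian E))
      ≤ ENNReal.ofReal (Real.exp (t ^ 2 * Real.pi ^ 2 / 8)) *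
        ∫⁻ x, ENNReal.ofReal
          (Real.exp (t * (N * (1 - Real.cos (Real.pi / (2 * N)))) * supInner v x))
          ∂(stdGaussian E) := by
  have hm := measurable_supInner v
  have hN' : (0 : ℝ) < N := by exact_mod_cast hN
  set δ : ℝ := Real.pi / (2 * N) with hδ
  have hNδ : N * δ = Real.pi / 2 := by rw [hδ]; field_simp
  set f : E × E → ENNReal := fun p => ENNReal.ofReal
    (Real.exp ((N * t) * (supInner v p.1 - supInner v (Real.cos δ • p.1 + Real.sin δ • p.2))))
    with hf
  have hfm : Measurable f := by fun_prop
  set g : ℕ → E × E → ℝ := fun m p => supInner v (Real.cos (m * δ) • p.1 + Real.sin (m * δ) • p.2)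
    with hg
  have hfg : ∀ (m : ℕ) p, f (ContinuousLinearMap.rotation (m * δ) p) =
      ENNReal.ofReal (Real.exp ((N * t) * (g m p - g (m + 1) p))) := by
    intro m p
    simp only [hf, hg, ContinuousLinearMap.rotation_apply]
    congr 5
    push_cast
    rw [add_mul, one_mul, Real.cos_add, Real.sin_add]
    module
  have key : ∀ p : E × E, ENNReal.ofReal (Real.exp (t * (supInner v p.1 - supInner v p.2))) ≤
      ∑ m ∈ Finset.range N, ENNReal.ofReal (1 / N) *
        f (ContinuousLinearMap.rotation (m * δ) p) := by
    intro p
    have h0 : g 0 p = supInner v p.1 := by simp [hg]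
    have h1 : g N p = supInner v p.2 := by simp [hg, hNδ]
    have hs : ∑ m ∈ Finset.range N, (g m p - g (m + 1) p) = g 0 p - g N p :=
      Finset.sum_range_sub' _ _
    rw [h0, h1] at hs
    have hc := convexOn_exp.map_sum_le (t := Finset.range N) (w := fun _ => (1 / N : ℝ))
      (p := fun m => (N * t) * (g m p - g (m + 1) p)) (fun _ _ => by positivity)
      (by simp [hN'.ne']) (fun _ _ => Set.mem_univ _)
    have he : ∑ m ∈ Finset.range N, (1 / N : ℝ) • ((N * t) * (g m p - g (m + 1) p)) =
        t * (supInner v p.1 - supInner v p.2) := by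
      rw [← hs, Finset.mul_sum]
      refine Finset.sum_congr rfl fun m _ => ?_
      rw [smul_eq_mul]
      field_simp
    rw [he] at hc
    refine (ENNReal.ofReal_le_ofReal hc).trans (le_of_eq ?_)
    rw [ENNReal.ofReal_sum_of_nonneg (fun _ _ => by positivity)]
    refine Finset.sum_congr rfl fun m _ => ?_
    rw [hfg, smul_eq_mul, ENNReal.ofReal_mul (by positivity)]
  -- The factor `N` from convexity cancels the arc length `π / (2N)`, so the variance term is
  -- bounded uniformly in `N`.
  have hsin : (N * t) ^ 2 * Real.sin δ ^ 2 / 2 ≤ t ^ 2 * Real.pi ^ 2 / 8 := by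
    have h1 : Real.sin δ ^ 2 ≤ δ ^ 2 := Real.sin_sq_le_sq
    have h2 : (N * t) ^ 2 * δ ^ 2 = t ^ 2 * (Real.pi ^ 2 / 4) := by
      rw [mul_pow, mul_right_comm, ← mul_pow, hNδ]; ring
    nlinarith [mul_le_mul_of_nonneg_left h1 (sq_nonneg (N * t))]
  calc _ ≤ ∫⁻ p : E × E, ∑ m ∈ Finset.range N, ENNReal.ofReal (1 / N) *
        f (ContinuousLinearMap.rotation (m * δ) p)
          ∂((stdGaussian E).prod (stdGaussian E)) := lintegral_mono key
    _ = ∫⁻ p, f p ∂((stdGaussian E).prod (stdGaussian E)) := by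
        rw [lintegral_finsetSum _ (fun m _ => by fun_prop)]
        simp_rw [lintegral_const_mul' _ _ ENNReal.ofReal_ne_top,
          lintegral_comp_rotation_stdGaussian_prod hfm]
        rw [Finset.sum_const, Finset.card_range, nsmul_eq_mul, ← mul_assoc,
          ← ENNReal.ofReal_natCast, ← ENNReal.ofReal_mul hN'.le, mul_one_div_cancel hN'.ne']
        simp
    _ ≤ _ := lintegral_exp_supInner_sub_le hv (by positivity) _ _
    _ ≤ _ := by
        rw [show (N * t * (1 - Real.cos δ) : ℝ) = t * (N * (1 - Real.cos δ)) by ring]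
        gcongr

/-- Let `N → ∞`: the drift `N(1 - cos(π/(2N)))` is of order `1/N`, and the moment generating
function is continuous at 0 with value 1. -/
theorem lintegral_exp_supInner_sub_le_exp {v : ι → E} (hv : ∀ j, ‖v j‖ ≤ 1) {t : ℝ}
    (ht : 0 ≤ t) :
    ∫⁻ p : E × E, ENNReal.ofReal (Real.exp (t * (supInner v p.1 - supInner v p.2)))
        ∂((stdGaussian E).prod (stdGaussian E))
      ≤ ENNReal.ofReal (Real.exp (t ^ 2 * Real.pi ^ 2 / 8)) := by
  have hlim : Filter.Tendsto (fun N : ℕ => (N : ℝ) * (1 - Real.cos (Real.pi / (2 * N))))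
      Filter.atTop (nhds 0) := by
    refine squeeze_zero' (g := fun N : ℕ => Real.pi ^ 2 / 8 / (N : ℝ))
      (Filter.Eventually.of_forall fun N => ?_) ?_ (tendsto_const_div_atTop_nhds_zero_nat _)
    · have := Real.cos_le_one (Real.pi / (2 * N))
      exact mul_nonneg (Nat.cast_nonneg _) (by linarith)
    · filter_upwards [Filter.eventually_gt_atTop 0] with N hN
      have hN' : (0 : ℝ) < N := by exact_mod_cast hN
      have h := Real.one_sub_sq_div_two_le_cos (x := Real.pi / (2 * N))
      calc (N : ℝ) * (1 - Real.cos (Real.pi / (2 * N)))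
          ≤ N * ((Real.pi / (2 * N)) ^ 2 / 2) := by gcongr; linarith
        _ = Real.pi ^ 2 / 8 / N := by field_simp; norm_num
  have hmgf := (continuous_mgf (X := supInner v) (μ := stdGaussian E)
    (integrable_exp_supInner v)).tendsto 0
  rw [mgf_zero] at hmgf
  have h2 : Filter.Tendsto (fun N : ℕ => t * ((N : ℝ) * (1 - Real.cos (Real.pi / (2 * N)))))
      Filter.atTop (nhds 0) := by simpa using hlim.const_mul t
  have h3 := (ENNReal.tendsto_ofReal (hmgf.comp h2))
  have h4 := ENNReal.Tendsto.const_mul (a := ENNReal.ofReal (Real.exp (t ^ 2 * Real.pi ^ 2 / 8)))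
    h3 (Or.inr ENNReal.ofReal_ne_top)
  rw [ENNReal.ofReal_one, mul_one] at h4
  refine ge_of_tendsto h4 ?_
  filter_upwards [Filter.eventually_gt_atTop 0] with N hN
  refine (lintegral_exp_supInner_sub_le_of_steps hv ht hN).trans (le_of_eq ?_)
  rw [← ofReal_integral_eq_lintegral_ofReal (integrable_exp_supInner v _)
    (ae_of_all _ fun _ => (Real.exp_pos _).le)]
  rfl

/-- Gaussian concentration for the support function of a finite subset of the unit ball. -/
theorem lintegral_exp_supInner_le {v : ι → E} (hv : ∀ j, ‖v j‖ ≤ 1) {t : ℝ} (ht : 0 ≤ t) :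
    ∫⁻ x, ENNReal.ofReal (Real.exp (t * supInner v x)) ∂(stdGaussian E) ≤
      ENNReal.ofReal (Real.exp (t * ∫ x, supInner v x ∂(stdGaussian E) +
        t ^ 2 * Real.pi ^ 2 / 8)) := by
  have hm := measurable_supInner v
  set m := ∫ x, supInner v x ∂(stdGaussian E) with hm'
  have h := lintegral_exp_supInner_sub_le_exp hv ht
  -- Jensen for the independent copy replaces it by its mean.
  have hJ : ENNReal.ofReal (Real.exp (-(t * m))) ≤
      ∫⁻ x, ENNReal.ofReal (Real.exp (-(t * supInner v x))) ∂(stdGaussian E) := by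
    have := ofReal_exp_integral_le_lintegral (((integrable_supInner v).const_mul t).neg)
    simpa [integral_neg, integral_const_mul, ← hm'] using this
  have hprod : ∫⁻ p : E × E, ENNReal.ofReal (Real.exp (t * (supInner v p.1 - supInner v p.2)))
        ∂((stdGaussian E).prod (stdGaussian E)) =
      (∫⁻ x, ENNReal.ofReal (Real.exp (t * supInner v x)) ∂(stdGaussian E)) *
      ∫⁻ x, ENNReal.ofReal (Real.exp (-(t * supInner v x))) ∂(stdGaussian E) := by
    rw [← lintegral_prod_mul (by fun_prop) (by fun_prop)]
    refine lintegral_congr fun p => ?_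
    rw [← ENNReal.ofReal_mul (Real.exp_pos _).le, ← Real.exp_add]
    congr 2
    ring
  rw [hprod] at h
  calc _ = (∫⁻ x, ENNReal.ofReal (Real.exp (t * supInner v x)) ∂(stdGaussian E)) *
        ENNReal.ofReal (Real.exp (-(t * m))) * ENNReal.ofReal (Real.exp (t * m)) := by
        rw [mul_assoc, ← ENNReal.ofReal_mul (Real.exp_pos _).le, ← Real.exp_add]
        simp
    _ ≤ ENNReal.ofReal (Real.exp (t ^ 2 * Real.pi ^ 2 / 8)) *
        ENNReal.ofReal (Real.exp (t * m)) := by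
        gcongr
        exact (mul_le_mul_right hJ _).trans h
    _ = _ := by
        rw [← ENNReal.ofReal_mul (Real.exp_pos _).le, ← Real.exp_add, add_comm]

end GaussianSup

/-! ### Linear images and second moments of Gaussian vectors -/

section LinearImages

variable {E F : Type*} [NormedAddCommGroup E] [InnerProductSpace ℝ E] [FiniteDimensional ℝ E]
  [MeasurableSpace E] [BorelSpace E] [NormedAddCommGroup F] [InnerProductSpace ℝ F]
  [FiniteDimensional ℝ F] [MeasurableSpace F] [BorelSpace F]

/-- The characteristic function of the image at `t` depends only on the norm of the adjoint `M t`.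
-/
theorem map_stdGaussian_of_norm_adjoint {L : E → F} (hL : Measurable L) {M : F → E} {c : ℝ}
    (hLM : ∀ x t, inner ℝ (L x) t = inner ℝ x (M t)) (hM : ∀ t, ‖M t‖ = c * ‖t‖) :
    (stdGaussian E).map L = (stdGaussian F).map (c • ·) := by
  have : IsProbabilityMeasure ((stdGaussian E).map L) :=
    Measure.isProbabilityMeasure_map hL.aemeasurable
  have : IsProbabilityMeasure ((stdGaussian F).map (c • ·)) :=
    Measure.isProbabilityMeasure_map (by fun_prop)
  refine Measure.ext_of_charFun (funext fun t => ?_)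
  rw [charFun_map_smul, charFun_stdGaussian, charFun_apply,
    integral_map hL.aemeasurable (by fun_prop)]
  simp_rw [hLM]
  rw [← charFun_apply, charFun_stdGaussian, hM, norm_smul]
  congr 3
  norm_cast
  rw [mul_pow, mul_pow, Real.norm_eq_abs, sq_abs]

theorem integral_inner_mul_inner_stdGaussian (u v : E) :
    ∫ x, inner ℝ x u * inner ℝ x v ∂(stdGaussian E) = inner ℝ u v := by
  have h := covarianceBilin_apply_eq_cov (μ := stdGaussian E) IsGaussian.memLp_two_id u v
  rw [covarianceBilin_stdGaussian, covariance_eq_sub] at h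
  · have h0 : ∫ x, inner ℝ u x ∂(stdGaussian E) = 0 :=
      integral_strongDual_stdGaussian (innerSL ℝ u)
    simp only [h0, zero_mul, sub_zero] at h
    rw [innerSL_apply_apply] at h
    rw [h]
    simp [real_inner_comm]
  · exact IsGaussian.memLp_dual _ (innerSL ℝ u) 2 (by simp)
  · exact IsGaussian.memLp_dual _ (innerSL ℝ v) 2 (by simp)

theorem integrable_inner_mul_inner_stdGaussian (u v : E) :
    Integrable (fun x => inner ℝ x u * inner ℝ x v) (stdGaussian E) := by
  have h := (IsGaussian.memLp_dual (stdGaussian E) (innerSL ℝ u) 2 (by simp)).integrable_mul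
    (IsGaussian.memLp_dual (stdGaussian E) (innerSL ℝ v) 2 (by simp))
  refine h.congr (ae_of_all _ fun x => ?_)
  simp [real_inner_comm]

end LinearImages

/-! ### Exponential moments of the chi-square law -/

section ChiSquare

theorem gaussianPDFReal_smul_exp_mul_sq (s x : ℝ) :
    gaussianPDFReal 0 1 x • Real.exp (s * x ^ 2) =
      (√(2 * Real.pi))⁻¹ * Real.exp (-(1 / 2 - s) * x ^ 2) := by
  rw [gaussianPDFReal, smul_eq_mul, mul_assoc, ← Real.exp_add]
  congr 2
  · simp
  · push_cast
    ring

theorem integrable_exp_mul_sq_gaussianReal {s : ℝ} (hs : s < 1 / 2) :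
    Integrable (fun x => Real.exp (s * x ^ 2)) (gaussianReal 0 1) := by
  rw [gaussianReal_of_var_ne_zero _ one_ne_zero,
    integrable_withDensity_iff_integrable_smul' (measurable_gaussianPDF _ _)
      (ae_of_all _ fun _ => gaussianPDF_lt_top)]
  simp_rw [toReal_gaussianPDF, gaussianPDFReal_smul_exp_mul_sq]
  exact (integrable_exp_neg_mul_sq (by linarith)).const_mul _

theorem integral_exp_mul_sq_gaussianReal_le {s : ℝ} (hs0 : 0 ≤ s) (hs : s ≤ 1 / 4) :
    ∫ x, Real.exp (s * x ^ 2) ∂(gaussianReal 0 1) ≤ Real.exp (2 * s) := by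
  rw [integral_gaussianReal_eq_integral_smul one_ne_zero]
  simp_rw [gaussianPDFReal_smul_exp_mul_sq]
  rw [integral_const_mul, integral_gaussian, ← Real.sqrt_inv, ← Real.sqrt_mul (by positivity)]
  refine Real.sqrt_le_iff.2 ⟨(Real.exp_pos _).le, ?_⟩
  have h1 : (2 * Real.pi)⁻¹ * (Real.pi / (1 / 2 - s)) = 1 / (1 - 2 * s) := by
    have : (1 / 2 - s) ≠ 0 := by linarith
    have : (1 - 2 * s) ≠ 0 := by linarith
    have := Real.pi_ne_zero
    field_simp
  -- The squared inequality is `1 ≤ exp(4s)(1 - 2s)`, which follows from `(1 + 4s)(1 - 2s) = 1 +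
  -- 8s(1/4 - s)`.
  rw [h1, div_le_iff₀ (by linarith), ← Real.exp_nat_mul]
  push_cast
  nlinarith [mul_le_mul_of_nonneg_right (Real.add_one_le_exp (2 * (2 * s)))
    (by linarith : 0 ≤ 1 - 2 * s), mul_nonneg hs0 (by linarith : 0 ≤ 1 / 4 - s)]

theorem lintegral_exp_mul_norm_sq_stdGaussian_le {s : ℝ} (hs0 : 0 ≤ s) (hs : s ≤ 1 / 4) (k : ℕ) :
    ∫⁻ x, ENNReal.ofReal (Real.exp (s * ‖x‖ ^ 2)) ∂(stdGaussian (EuclideanSpace ℝ (Fin k))) ≤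
      ENNReal.ofReal (Real.exp (k * (2 * s))) := by
  rw [← map_pi_eq_stdGaussian, lintegral_map (by fun_prop) (by fun_prop)]
  simp_rw [EuclideanSpace.real_norm_sq_eq, Finset.mul_sum, Real.exp_sum]
  rw [← ofReal_integral_eq_lintegral_ofReal
    (Integrable.fintype_prod fun _ => integrable_exp_mul_sq_gaussianReal (by linarith))
    (ae_of_all _ fun _ => Finset.prod_nonneg fun _ _ => (Real.exp_pos _).le)]
  refine ENNReal.ofReal_le_ofReal ?_
  rw [integral_fintype_prod_eq_pow (f := fun x : ℝ => Real.exp (s * x ^ 2)), Fintype.card_fin,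
    Real.exp_nat_mul]
  exact pow_le_pow_left₀ (integral_nonneg fun _ => (Real.exp_pos _).le)
    (integral_exp_mul_sq_gaussianReal_le hs0 hs) k

end ChiSquare

/-! ### Decoupling the quadratic form -/

section Decoupling

variable {E : Type*} [NormedAddCommGroup E] [InnerProductSpace ℝ E] {k : ℕ}

/-- The coefficients `⟨G a, u⟩` of `u` with respect to the rows of `G`. -/
def rowInner (u : E) (G : PiLp 2 fun _ : Fin k => E) : EuclideanSpace ℝ (Fin k) :=
  WithLp.toLp 2 fun a => inner ℝ (G a) u

/-- The combination `∑ a, w a • H a` of the rows of `H`. -/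
def rowComb (w : EuclideanSpace ℝ (Fin k)) (H : PiLp 2 fun _ : Fin k => E) : E :=
  ∑ a, w a • H a

theorem inner_rowComb_eq (w : EuclideanSpace ℝ (Fin k)) (H : PiLp 2 fun _ : Fin k => E) (v : E) :
    inner ℝ (rowComb w H) v = inner ℝ H (WithLp.toLp 2 fun a => w a • v) := by
  simp [rowComb, PiLp.inner_apply, sum_inner, real_inner_smul_left, real_inner_smul_right]

theorem inner_rowInner_eq (u : E) (G : PiLp 2 fun _ : Fin k => E) (w : EuclideanSpace ℝ (Fin k)) :
    inner ℝ (rowInner u G) w = inner ℝ G (WithLp.toLp 2 fun a => w a • u) := by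
  simp [rowInner, PiLp.inner_apply, real_inner_smul_right]

theorem norm_toLp_smul (w : EuclideanSpace ℝ (Fin k)) (v : E) :
    ‖(WithLp.toLp 2 fun a => w a • v : PiLp 2 fun _ : Fin k => E)‖ = ‖w‖ * ‖v‖ := by
  rw [← sq_eq_sq₀ (norm_nonneg _) (by positivity), mul_pow, PiLp.norm_sq_eq_of_L2,
    EuclideanSpace.real_norm_sq_eq, Finset.sum_mul]
  simp [norm_smul, mul_pow]

theorem rowInner_smul (u : E) (c : ℝ) (G : PiLp 2 fun _ : Fin k => E) :
    rowInner u (c • G) = c • rowInner u G := by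
  ext a; simp [rowInner, real_inner_smul_left]

theorem rowInner_add (u : E) (G H : PiLp 2 fun _ : Fin k => E) :
    rowInner u (G + H) = rowInner u G + rowInner u H := by
  ext a; simp [rowInner, inner_add_left]

theorem inner_apply_eq_inner_single (u : E) (a : Fin k) (G : PiLp 2 fun _ : Fin k => E) :
    inner ℝ (G a) u = inner ℝ G (PiLp.single 2 a u) := by
  rw [PiLp.inner_apply, Finset.sum_eq_single a] <;> simp +contextual

theorem inner_rowComb_rowInner (u v : E) (G H : PiLp 2 fun _ : Fin k => E) :
    inner ℝ (rowComb (rowInner u G) H) v = ∑ a, inner ℝ (G a) u * inner ℝ (H a) v := by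
  simp [rowComb, rowInner, sum_inner, real_inner_smul_left]

theorem inner_rowComb_rowInner_swap (u v : E) (G H : PiLp 2 fun _ : Fin k => E) :
    inner ℝ (rowComb (rowInner u G) H) v = inner ℝ (rowComb (rowInner v H) G) u := by
  simp_rw [inner_rowComb_rowInner, mul_comm]

/-- For fixed `G` the two cross terms are linear in `H`, hence centred; only the two diagonal terms
survive averaging over `H`. -/
theorem inner_rowComb_rowInner_add_sub (u v : E) (G H : PiLp 2 fun _ : Fin k => E) :
    inner ℝ (rowComb (rowInner u (G + H)) (H - G)) v =
      inner ℝ (rowComb (rowInner u G) H) v - inner ℝ (rowComb (rowInner u G) G) v +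
        (inner ℝ (rowComb (rowInner u H) H) v - inner ℝ (rowComb (rowInner v G) H) u) := by
  rw [inner_rowComb_rowInner_swap v u G H]
  simp_rw [inner_rowComb_rowInner, ← Finset.sum_sub_distrib, ← Finset.sum_add_distrib]
  refine Finset.sum_congr rfl fun a _ => ?_
  simp only [PiLp.add_apply, PiLp.sub_apply, inner_add_left, inner_sub_left]
  ring

variable {ι : Type*}

/-- Each rotated component carries a factor `1/√2`, and the form is bilinear. -/
theorem supInner_rowComb_rotation (v : ι → E) (u : E) (G H : PiLp 2 fun _ : Fin k => E) :
    supInner v (rowComb (rowInner u (ContinuousLinearMap.rotation (Real.pi / 4) (G, H)).1)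
      (ContinuousLinearMap.rotation (Real.pi / 4) (G, H)).2) =
      1 / 2 * supInner v (rowComb (rowInner u (G + H)) (H - G)) := by
  rw [← supInner_smul v (by norm_num), ContinuousLinearMap.rotation_apply, Real.cos_pi_div_four,
    Real.sin_pi_div_four]
  congr 1
  have h1 : (√2 / 2) • G + (√2 / 2) • H = (√2 / 2) • (G + H) := by module
  have h2 : -(√2 / 2) • G + (√2 / 2) • H = (√2 / 2) • (H - G) := by module
  simp only [h1, h2, rowInner_smul]
  simp only [rowComb, PiLp.smul_apply, smul_eq_mul, Finset.smul_sum, smul_smul]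
  refine Finset.sum_congr rfl fun a _ => ?_
  congr 1
  have : √2 * √2 = (2 : ℝ) := Real.mul_self_sqrt (by norm_num)
  linear_combination (rowInner u (G + H) a / 4) * this

variable [FiniteDimensional ℝ E] [MeasurableSpace E] [BorelSpace E]

@[fun_prop]
theorem measurable_rowInner (u : E) : Measurable (rowInner u (k := k)) := by
  unfold rowInner
  fun_prop

@[fun_prop]
theorem Measurable.rowComb {α : Type*} [MeasurableSpace α] {f : α → EuclideanSpace ℝ (Fin k)}
    {g : α → PiLp 2 fun _ : Fin k => E} (hf : Measurable f) (hg : Measurable g) :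
    Measurable fun x => rowComb (f x) (g x) := by
  unfold _root_.rowComb
  fun_prop

theorem map_rowComb_stdGaussian (w : EuclideanSpace ℝ (Fin k)) :
    (stdGaussian (PiLp 2 fun _ : Fin k => E)).map (rowComb w) =
      (stdGaussian E).map (‖w‖ • ·) :=
  map_stdGaussian_of_norm_adjoint (by fun_prop) (inner_rowComb_eq w) (norm_toLp_smul w)

theorem map_rowInner_stdGaussian {u : E} (hu : ‖u‖ = 1) :
    (stdGaussian (PiLp 2 fun _ : Fin k => E)).map (rowInner u) =
      stdGaussian (EuclideanSpace ℝ (Fin k)) := by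
  rw [map_stdGaussian_of_norm_adjoint (c := 1) (by fun_prop) (inner_rowInner_eq u)
    (fun t => by rw [norm_toLp_smul, hu, mul_comm])]
  simp

theorem integrable_inner_rowComb (w : EuclideanSpace ℝ (Fin k)) (v : E) :
    Integrable (fun H => inner ℝ (rowComb w H) v) (stdGaussian (PiLp 2 fun _ : Fin k => E)) := by
  simp_rw [inner_rowComb_eq]
  simp_rw [fun H : PiLp 2 fun _ : Fin k => E =>
    real_inner_comm (WithLp.toLp 2 fun a => w a • v) H]
  exact IsGaussian.integrable_dual _ (innerSL ℝ (WithLp.toLp 2 fun a => w a • v))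

theorem integral_inner_rowComb (w : EuclideanSpace ℝ (Fin k)) (v : E) :
    ∫ H, inner ℝ (rowComb w H) v ∂(stdGaussian (PiLp 2 fun _ : Fin k => E)) = 0 := by
  simp_rw [inner_rowComb_eq]
  simp_rw [fun H : PiLp 2 fun _ : Fin k => E =>
    real_inner_comm (WithLp.toLp 2 fun a => w a • v) H]
  exact integral_strongDual_stdGaussian (innerSL ℝ (WithLp.toLp 2 fun a => w a • v))

theorem integrable_inner_rowComb_rowInner_self (u v : E) :
    Integrable (fun G => inner ℝ (rowComb (rowInner u G) G) v)
      (stdGaussian (PiLp 2 fun _ : Fin k => E)) := by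
  simp_rw [inner_rowComb_rowInner, inner_apply_eq_inner_single]
  exact integrable_finsetSum _ fun a _ => integrable_inner_mul_inner_stdGaussian _ _

theorem integral_inner_rowComb_rowInner_self (u v : E) :
    ∫ G, inner ℝ (rowComb (rowInner u G) G) v ∂(stdGaussian (PiLp 2 fun _ : Fin k => E)) =
      k * inner ℝ u v := by
  simp_rw [inner_rowComb_rowInner, inner_apply_eq_inner_single]
  rw [integral_finsetSum _ fun a _ => integrable_inner_mul_inner_stdGaussian _ _]
  simp_rw [integral_inner_mul_inner_stdGaussian, ← inner_apply_eq_inner_single]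
  simp

theorem integrable_inner_rowComb_rowInner_add_sub (u v : E) (G : PiLp 2 fun _ : Fin k => E) :
    Integrable (fun H => inner ℝ (rowComb (rowInner u (G + H)) (H - G)) v)
      (stdGaussian (PiLp 2 fun _ : Fin k => E)) := by
  simp_rw [inner_rowComb_rowInner_add_sub]
  exact ((integrable_inner_rowComb _ _).sub (integrable_const _)).add
    ((integrable_inner_rowComb_rowInner_self _ _).sub (integrable_inner_rowComb _ _))

theorem integral_inner_rowComb_rowInner_add_sub (u v : E) (G : PiLp 2 fun _ : Fin k => E) :
    ∫ H, inner ℝ (rowComb (rowInner u (G + H)) (H - G)) v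
        ∂(stdGaussian (PiLp 2 fun _ : Fin k => E)) =
      k * inner ℝ u v - inner ℝ (rowComb (rowInner u G) G) v := by
  simp_rw [inner_rowComb_rowInner_add_sub]
  have h1 := integrable_inner_rowComb (rowInner u G) v
  have h2 := integrable_inner_rowComb (rowInner v G) u
  have h3 := integrable_inner_rowComb_rowInner_self (k := k) u v
  rw [integral_add (by exact h1.sub (integrable_const _)) (by exact h3.sub h2),
    integral_sub h1 (integrable_const _), integral_sub h3 h2, integral_inner_rowComb,
    integral_inner_rowComb, integral_inner_rowComb_rowInner_self]
  simp
  ring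

variable [Fintype ι]

theorem ofReal_exp_le_lintegral_supInner_decoupled (v : ι → E) (u : E) {t : ℝ} (ht : 0 ≤ t)
    (G : PiLp 2 fun _ : Fin k => E) (j : ι) :
    ENNReal.ofReal (Real.exp (t * (k * inner ℝ u (v j) -
        inner ℝ (rowComb (rowInner u G) G) (v j)))) ≤
      ∫⁻ H, ENNReal.ofReal (Real.exp (t * supInner v (rowComb (rowInner u (G + H)) (H - G))))
        ∂(stdGaussian (PiLp 2 fun _ : Fin k => E)) := by
  rw [← integral_inner_rowComb_rowInner_add_sub, ← integral_const_mul]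
  refine (ofReal_exp_integral_le_lintegral
    ((integrable_inner_rowComb_rowInner_add_sub u (v j) G).const_mul t)).trans
    (lintegral_mono fun H => ?_)
  gcongr
  exact inner_le_supInner v _ j

variable [Nonempty ι]

theorem lintegral_exp_supInner_rowComb_le {v : ι → E} (hv : ∀ j, ‖v j‖ ≤ 1) {t : ℝ} (ht : 0 ≤ t)
    (w : EuclideanSpace ℝ (Fin k)) :
    ∫⁻ H, ENNReal.ofReal (Real.exp (2 * t * supInner v (rowComb w H)))
        ∂(stdGaussian (PiLp 2 fun _ : Fin k => E)) ≤
      ENNReal.ofReal (Real.exp ((∫ x, supInner v x ∂(stdGaussian E)) ^ 2 / 2)) *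
        ENNReal.ofReal (Real.exp (7 * t ^ 2 * ‖w‖ ^ 2)) := by
  have hm := measurable_supInner v
  have h1 : ∫⁻ H, ENNReal.ofReal (Real.exp (2 * t * supInner v (rowComb w H)))
        ∂(stdGaussian (PiLp 2 fun _ : Fin k => E)) =
      ∫⁻ x, ENNReal.ofReal (Real.exp (2 * t * ‖w‖ * supInner v x)) ∂(stdGaussian E) := by
    rw [← lintegral_map (f := fun x => ENNReal.ofReal (Real.exp (2 * t * supInner v x)))
      (g := rowComb w) (by fun_prop) (by fun_prop), map_rowComb_stdGaussian,
      lintegral_map (by fun_prop) (by fun_prop)]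
    simp_rw [supInner_smul v (norm_nonneg w), mul_assoc]
  rw [h1, ← ENNReal.ofReal_mul (Real.exp_pos _).le, ← Real.exp_add]
  refine (lintegral_exp_supInner_le hv (by positivity)).trans
    (ENNReal.ofReal_le_ofReal (Real.exp_le_exp.2 ?_))
  set m := ∫ x, supInner v x ∂(stdGaussian E)
  have hpi : Real.pi ^ 2 ≤ 10 := by nlinarith [Real.pi_pos, Real.pi_lt_d2]
  -- The constant is 7 = 2 + 5: `2t‖w‖m ≤ m²/2 + 2t²‖w‖²`, and the variance term `(2t‖w‖)²π²/8` is
  -- at most `5t²‖w‖²`.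
  nlinarith [sq_nonneg (m - 2 * t * ‖w‖), mul_le_mul_of_nonneg_left hpi (sq_nonneg (t * ‖w‖))]

theorem lintegral_exp_supInner_decoupled_le {v : ι → E} (hv : ∀ j, ‖v j‖ ≤ 1) {u : E}
    (hu : ‖u‖ = 1) {t : ℝ} (ht : 0 ≤ t) (ht' : 7 * t ^ 2 ≤ 1 / 4) :
    ∫⁻ G, ∫⁻ H, ENNReal.ofReal
        (Real.exp (t * supInner v (rowComb (rowInner u (G + H)) (H - G))))
        ∂(stdGaussian (PiLp 2 fun _ : Fin k => E)) ∂(stdGaussian (PiLp 2 fun _ : Fin k => E)) ≤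
      ENNReal.ofReal (Real.exp ((∫ x, supInner v x ∂(stdGaussian E)) ^ 2 / 2 +
        14 * t ^ 2 * k)) := by
  have hm := measurable_supInner v
  have hfm : Measurable fun p : (PiLp 2 fun _ : Fin k => E) × (PiLp 2 fun _ : Fin k => E) =>
      ENNReal.ofReal (Real.exp (2 * t * supInner v (rowComb (rowInner u p.1) p.2))) := by
    fun_prop
  have hrot := lintegral_lintegral_comp_rotation_stdGaussian hfm (Real.pi / 4)
  simp only [supInner_rowComb_rotation] at hrot
  have hw := lintegral_map (μ := stdGaussian (PiLp 2 fun _ : Fin k => E))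
    (f := fun w => ENNReal.ofReal (Real.exp (7 * t ^ 2 * ‖w‖ ^ 2))) (g := rowInner u)
    (by fun_prop) (by fun_prop)
  rw [map_rowInner_stdGaussian hu] at hw
  simp_rw [show ∀ x : ℝ, t * x = 2 * t * (1 / 2 * x) by intro x; ring]
  rw [hrot]
  refine (lintegral_mono fun G => lintegral_exp_supInner_rowComb_le hv ht _).trans ?_
  rw [lintegral_const_mul _ (by fun_prop), ← hw, Real.exp_add,
    ENNReal.ofReal_mul (Real.exp_pos _).le]
  gcongr
  refine (lintegral_exp_mul_norm_sq_stdGaussian_le (by positivity) ht' k).trans (le_of_eq ?_)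
  congr 2
  ring

end Decoupling

/-! ### Choice of a good Gaussian matrix -/

section Existence

variable {E : Type*} [NormedAddCommGroup E] [InnerProductSpace ℝ E] [FiniteDimensional ℝ E]
  [MeasurableSpace E] [BorelSpace E] {ι κ : Type*} [Fintype ι] [Nonempty ι] [Fintype κ]
  [Nonempty κ]

theorem exists_rows_deviation_le (k : ℕ) {v : ι → E} (hv : ∀ j, ‖v j‖ ≤ 1) {u : κ → E}
    (hu : ∀ i, ‖u i‖ = 1) {t : ℝ} (ht : 0 ≤ t) (ht' : 7 * t ^ 2 ≤ 1 / 4) :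
    ∃ G : PiLp 2 fun _ : Fin k => E, ∀ i j,
      t * (k * inner ℝ (u i) (v j) - inner ℝ (rowComb (rowInner (u i) G) G) (v j)) ≤
        Real.log (Fintype.card κ) +
          ((∫ x, supInner v x ∂(stdGaussian E)) ^ 2 / 2 + 14 * t ^ 2 * k) := by
  have hm := measurable_supInner v
  set B := (∫ x, supInner v x ∂(stdGaussian E)) ^ 2 / 2 + 14 * t ^ 2 * k with hB
  have hmeas : ∀ i, Measurable fun G : PiLp 2 fun _ : Fin k => E => ∫⁻ H, ENNReal.ofReal
        (Real.exp (t * supInner v (rowComb (rowInner (u i) (G + H)) (H - G))))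
        ∂(stdGaussian (PiLp 2 fun _ : Fin k => E)) := fun i =>
    Measurable.lintegral_prod_right (by fun_prop)
  -- Some `G` does no worse than average for the sum over `κ`, and each summand bounds all `j` at
  -- once.
  obtain ⟨G, hG⟩ := exists_le_lintegral (μ := stdGaussian (PiLp 2 fun _ : Fin k => E))
    (Finset.measurable_fun_sum Finset.univ fun i _ => hmeas i).aemeasurable
  refine ⟨G, fun i j => ?_⟩
  have hcard : (0 : ℝ) < Fintype.card κ := by exact_mod_cast Fintype.card_pos
  rw [lintegral_finsetSum _ fun i _ => hmeas i] at hG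
  have h2 := hG.trans (Finset.sum_le_sum fun i _ =>
    lintegral_exp_supInner_decoupled_le hv (hu i) ht ht')
  have h3 := (ofReal_exp_le_lintegral_supInner_decoupled v (u i) ht G j).trans
    ((Finset.single_le_sum (f := fun i => ∫⁻ H, ENNReal.ofReal
        (Real.exp (t * supInner v (rowComb (rowInner (u i) (G + H)) (H - G))))
        ∂(stdGaussian (PiLp 2 fun _ : Fin k => E)))
      (fun _ _ => zero_le) (Finset.mem_univ i)).trans h2)
  rw [Finset.sum_const, Finset.card_univ, nsmul_eq_mul, ← ENNReal.ofReal_natCast,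
    ← ENNReal.ofReal_mul hcard.le, ENNReal.ofReal_le_ofReal_iff (by positivity)] at h3
  rw [← Real.exp_le_exp, Real.exp_add, Real.exp_log hcard]
  exact h3

end Existence

/-! ### From deviation bounds to the approximate rank -/

section ApproximateRank

variable {d n : ℕ}

theorem gaussianWidth_range_matCol (Y : Matrix (Fin d) (Fin n) ℝ) :
    gaussianWidth (Set.range (matCol Y)) =
      ∫ x, supInner (matCol Y) x ∂(stdGaussian (EuclideanSpace ℝ (Fin d))) := by
  unfold gaussianWidth supInner
  congr 1
  ext x
  exact iSup_range' (fun v : EuclideanSpace ℝ (Fin d) => (inner ℝ x v : ℝ)) _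

theorem approxRank_le {ε : ℝ} {Y Z : Matrix (Fin d) (Fin n) ℝ} (h : ∀ i j, |Y i j - Z i j| ≤ ε) :
    approxRank ε Y ≤ Z.rank :=
  Nat.sInf_le ⟨Z, h, rfl⟩

theorem inner_single_matCol (Y : Matrix (Fin d) (Fin n) ℝ) (i : Fin d) (j : Fin n) :
    inner ℝ (EuclideanSpace.single i (1 : ℝ)) (matCol Y j) = Y i j := by
  rw [EuclideanSpace.inner_single_left]
  simp [matCol]

theorem abs_apply_le_norm_matCol (Y : Matrix (Fin d) (Fin n) ℝ) (i : Fin d) (j : Fin n) :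
    |Y i j| ≤ ‖matCol Y j‖ :=
  PiLp.norm_apply_le (matCol Y j) i

/-- The matrix whose rows are the components of `G`. -/
def rowMatrix {k : ℕ} (G : PiLp 2 fun _ : Fin k => EuclideanSpace ℝ (Fin d)) :
    Matrix (Fin k) (Fin d) ℝ :=
  Matrix.of fun a l => G a l

theorem inner_rowComb_rowInner_single_matCol {k : ℕ}
    (G : PiLp 2 fun _ : Fin k => EuclideanSpace ℝ (Fin d)) (Y : Matrix (Fin d) (Fin n) ℝ)
    (i : Fin d) (j : Fin n) :
    inner ℝ (rowComb (rowInner (EuclideanSpace.single i 1) G) G) (matCol Y j) =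
      ((rowMatrix G).transpose * (rowMatrix G * Y)) i j := by
  rw [inner_rowComb_rowInner, Matrix.mul_apply]
  refine Finset.sum_congr rfl fun a _ => ?_
  simp [rowMatrix, matCol, Matrix.mul_apply, PiLp.inner_apply, mul_comm]

theorem approxRank_le_of_sq_mul_ge {Y : Matrix (Fin d) (Fin n) ℝ} (hd : 0 < d) (hn : 0 < n)
    (hY : ∀ j, ‖matCol Y j‖ ≤ 1) {ε : ℝ} (hε : 0 < ε) (hε1 : ε ≤ 1) {k : ℕ} (hk : 0 < k)
    (h : 56 * (Real.log (2 * d) + gaussianWidth (Set.range (matCol Y)) ^ 2 / 2) ≤ ε ^ 2 * k) :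
    approxRank ε Y ≤ k := by
  have : Nonempty (Fin d) := ⟨⟨0, hd⟩⟩
  have : Nonempty (Fin n) := ⟨⟨0, hn⟩⟩
  obtain ⟨G, hG⟩ := exists_rows_deviation_le k hY
    -- Both signs of each basis vector turn the one-sided bound into a two-sided one. With `t =
    -- ε/28` the term `14t²k` equals `ε²k/56`, half of the target `tεk`; the hypothesis `h` makes
    -- the rest at most the other half.
    (u := fun p : Fin d × Bool => (cond p.2 1 (-1) : ℝ) • EuclideanSpace.single p.1 (1 : ℝ))
    (by rintro ⟨i, b⟩; cases b <;> simp) (t := ε / 28) (by positivity)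
    (by nlinarith)
  have hk' : (0 : ℝ) < k := by exact_mod_cast hk
  have hcard : ((Fintype.card (Fin d × Bool) : ℕ) : ℝ) = 2 * d := by simp [mul_comm]
  rw [hcard, ← gaussianWidth_range_matCol] at hG
  set M := (rowMatrix G).transpose * (rowMatrix G * Y) with hM
  have hneg : ∀ i, rowInner (-EuclideanSpace.single i (1 : ℝ)) G =
      -rowInner (EuclideanSpace.single i 1) G := by
    intro i; ext a; simp [rowInner]
  have hbound : ∀ i j, |k * Y i j - M i j| ≤ ε * k := by
    intro i j
    have h1 := hG (i, true) j
    have h2 := hG (i, false) j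
    simp only [cond_true, cond_false, one_smul, neg_smul, hneg, inner_neg_left,
      inner_single_matCol] at h1 h2
    have h3 : rowComb (-rowInner (EuclideanSpace.single i 1) G) G =
        -rowComb (rowInner (EuclideanSpace.single i 1) G) G := by
      simp [rowComb]
    rw [h3, inner_neg_left] at h2
    rw [inner_rowComb_rowInner_single_matCol, ← hM] at h1 h2
    rw [abs_le]
    constructor
    · refine le_of_mul_le_mul_left ?_ (by positivity : 0 < ε / 28)
      nlinarith
    · refine le_of_mul_le_mul_left ?_ (by positivity : 0 < ε / 28)
      nlinarith
  refine (approxRank_le (Z := (rowMatrix G).transpose * ((k : ℝ)⁻¹ • (rowMatrix G * Y)))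
    fun i j => ?_).trans ((Matrix.rank_mul_le_left _ _).trans ?_)
  · rw [Matrix.mul_smul, ← hM, Matrix.smul_apply, smul_eq_mul]
    have : Y i j - (k : ℝ)⁻¹ * M i j = (k * Y i j - M i j) / k := by field_simp
    rw [this, abs_div, abs_of_pos hk', div_le_iff₀ hk']
    exact hbound i j
  · simpa using Matrix.rank_le_width (rowMatrix G).transpose

theorem approxRank_eq_zero {Y : Matrix (Fin d) (Fin n) ℝ} (hY : ∀ j, ‖matCol Y j‖ ≤ 1) {ε : ℝ}
    (hε : 1 ≤ ε) : approxRank ε Y = 0 := by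
  have h := approxRank_le (Y := Y) (Z := 0) (ε := ε) fun i j => by
    simpa using (abs_apply_le_norm_matCol Y i j).trans ((hY j).trans hε)
  simpa using h

end ApproximateRank

theorem lemmaF1 :
    ∀ c : ℝ, 0 < c → ∃ C : ℝ, 0 < C ∧
      ∀ (d n : ℕ), 1 ≤ d → 1 ≤ n →
        ∀ Y : Matrix (Fin d) (Fin n) ℝ, (∀ j, ‖matCol Y j‖ = 1) →
          ∀ ε : ℝ, c / Real.sqrt d ≤ ε → (d = 1 → 1 ≤ ε) →
            (approxRank ε Y : ℝ) ≤
              C * (1 / ε ^ 2 *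
                max (gaussianWidth (Set.range (matCol Y)) ^ 2) (Real.log d)) := by
  intro c hc
  -- Here 142 = 140 + 2: since `log 2 ≤ log d ≤ W`, the requirement on `k` is at most `56(2W + W/2)
  -- = 140W`; rounding up costs 1, which is at most `2W/ε²`.
  refine ⟨142, by norm_num, fun d n hd hn Y hY ε hε hd1 => ?_⟩
  set W := max (gaussianWidth (Set.range (matCol Y)) ^ 2) (Real.log d) with hW
  have hd0 : (0 : ℝ) < d := by exact_mod_cast hd
  have hε0 : 0 < ε := lt_of_lt_of_le (by positivity) hε
  have hW0 : 0 ≤ W := le_max_of_le_left (sq_nonneg _)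
  rcases le_or_gt 1 ε with h1 | h1
  · rw [approxRank_eq_zero (fun j => (hY j).le) h1, Nat.cast_zero]
    positivity
  -- For `d ≥ 2`, `W ≥ log 2 > 1/2`, which is what absorbs the terms `log 2` and 1.
  have hd2 : 2 ≤ d := by
    by_contra hlt
    exact absurd (hd1 (by omega)) (not_le.2 h1)
  have hlog : Real.log 2 ≤ Real.log d := Real.log_le_log (by norm_num) (by exact_mod_cast hd2)
  have hWd : Real.log d ≤ W := le_max_right _ _
  have hWω : gaussianWidth (Set.range (matCol Y)) ^ 2 ≤ W := le_max_left _ _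
  have hl2 := Real.log_two_gt_d9
  have hWpos : 0 < W := by linarith
  have hbig : 0 < 140 * W / ε ^ 2 := by positivity
  have hk := approxRank_le_of_sq_mul_ge (Y := Y) (by omega) (by omega) (fun j => (hY j).le) hε0
    h1.le (Nat.ceil_pos.2 hbig) (by
      have hle := Nat.le_ceil (140 * W / ε ^ 2)
      rw [div_le_iff₀ (by positivity)] at hle
      rw [Real.log_mul (by norm_num) hd0.ne']
      linarith)
  have hceil : ((⌈140 * W / ε ^ 2⌉₊ : ℕ) : ℝ) ≤ 140 * W / ε ^ 2 + 1 :=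
    (Nat.ceil_lt_add_one hbig.le).le
  have hone : 1 ≤ 2 * W / ε ^ 2 := by
    rw [le_div_iff₀ (by positivity)]
    nlinarith
  calc (approxRank ε Y : ℝ) ≤ (⌈140 * W / ε ^ 2⌉₊ : ℕ) := by exact_mod_cast hk
    _ ≤ 140 * W / ε ^ 2 + 2 * W / ε ^ 2 := by linarith
    _ = 142 * (1 / ε ^ 2 * W) := by ring
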